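/- Let $I_1,I_2,I_3\subseteq\mathbb R$ be nonempty open intervals (possibly unbounded), $I=I_1\times I_2\times I_3$, and let $f_1=f_1(x^2)$, $f_2=f_2(x^1)$, $f_3=f_3(x^3)$ be smooth nowhere zero functions on $I_2$, $I_1$, $I_3$, respectively. Then the Riemannian metric $$g=\frac{1}{f_1^2}(dx^1)^2+\frac{1}{f_2^2}(dx^2)^2+\frac{1}{f_3^2}(dx^3)^2$$ on $I$ is flat (its Riemann curvature tensor vanishes identically) if and only if one of the following holds: (1) $f_1=k_1$ on $I_2$ and $f_2=k_2$ on $I_1$, with $k_1,k_2\in\mathbb R\setminus\{0\}$; (2) $f_1(x^2)=\frac{k_1}{x^2-c_1}$ on $I_2$ and $f_2=k_2$ on $I_1$, with $k_1,k_2\in\mathbb R\setminus\{0\}$, $c_1\in\mathbb R\setminus I_2$; (3) $f_1=k_1$ on $I_2$ and $f_2(x^1)=\frac{k_2}{x^1-c_2}$ on $I_1$, with $k_1,k_2\in\mathbb R\setminus\{0\}$, $c_2\in\mathbb R\setminus I_1$; (4) $f_1(x^2)=\frac{k_1}{x^2-c_1}$ on $I_2$ and $f_2(x^1)=\frac{k_2}{x^1-c_2}$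 on $I_1$, with $k_1,k_2\in\mathbb R\setminus\{0\}$, $c_1\in\mathbb R\setminus I_2$, $c_2\in\mathbb R\setminus I_1$; (5) there are $k_1,k_2\in\mathbb R\setminus\{0\}$ with $k_2=-k_1$ such that, for each $(i,j)\in\{(1,2),(2,1)\}$, there are $r_i\in\mathbb R$, a maximal connected subset $D_i$ (a connected component) of $\{z\in\mathbb R\setminus\{0\} : -2k_i\ln|z|+r_i>0\}$, and an antiderivative $F_i$ on $D_i$ of $z\mapsto \frac{1}{\sqrt{-2k_i\ln|z|+r_i}}$, with inverse $F_i^{-1}:F_i(D_i)\to D_i$, for which one of the following two forms holds: (5a) there are $\eta_i\in\{\pm1\}$ and $d_i\in\mathbb R$ such that for all $t\in I_j$ one has $\eta_i t+d_i\in F_i(D_i)$ and $f_i(t)=\frac{1}{F_i^{-1}(\eta_i t+d_i)}$; (5b) there are $t_0\in I_j$ and $z_0\in\partial D_i\setminus\{0\}$ such that, with $\varepsilon_i=\operatorname{sign}(-k_iz_0)$ and $c_i=\lim_{z\to z_0,\,z\in D_i}F_i(z)-\varepsilon_i t_0$, for all $t\in I_j$, $$f_i(t)=\begin{cases}\dfrac{1}{F_i^{-1}(-\varepsilon_i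 t+2\varepsilon_i t_0+c_i)} & \text{if } t<t_0,\\[2mm] \dfrac{1}{\lim_{s\searrow t_0}F_i^{-1}(\varepsilon_i s+c_i)} & \text{if } t=t_0,\\[2mm] \dfrac{1}{F_i^{-1}(\varepsilon_i t+c_i)} & \text{if } t>t_0,\end{cases}$$ where all the arguments of $F_i^{-1}$ for $t\in I_j\setminus\{t_0\}$ lie in $F_i(D_i)$ and the limits exist. -/

import Mathlib

open scoped ContDiff

noncomputable section

/-- The partial derivative `∂h/∂xⁱ` at `x` of a function on `ℝⁿ`. -/
def partialD {n : ℕ} (i : Fin n) (h : (Fin n → ℝ) → ℝ) (x : Fin n → ℝ) : ℝ :=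
  fderiv ℝ h x (Pi.single i 1)

/-- The Christoffel symbol `Γˡᵢⱼ` of the Levi-Civita connection of the metric with matrix `g x` in
the standard coordinates:
`Γˡᵢⱼ = (1/2) ∑ₘ gˡᵐ (∂ᵢ gⱼₘ + ∂ⱼ gᵢₘ - ∂ₘ gᵢⱼ)`, that is, `∇_{∂ᵢ} ∂ⱼ = ∑ₗ Γˡᵢⱼ ∂ₗ`. -/
def christoffel {n : ℕ} (g : (Fin n → ℝ) → Matrix (Fin n) (Fin n) ℝ) (l i j : Fin n)
    (x : Fin n → ℝ) : ℝ :=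
  (1 / 2) * ∑ m, (g x)⁻¹ l m *
    (partialD i (fun y => g y j m) x + partialD j (fun y => g y i m) x
      - partialD m (fun y => g y i j) x)

/-- The components of the Riemann curvature tensor
`R(X,Y)Z = ∇_X ∇_Y Z - ∇_Y ∇_X Z - ∇_[X,Y] Z` in the standard coordinates:
`R(∂ᵢ,∂ⱼ)∂ₖ = ∑ₗ riemannCurv g l k i j · ∂ₗ`. -/
def riemannCurv {n : ℕ} (g : (Fin n → ℝ) → Matrix (Fin n) (Fin n) ℝ) (l k i j : Fin n)
    (x : Fin n → ℝ) : ℝ :=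
  partialD i (christoffel g l j k) x - partialD j (christoffel g l i k) x
    + ∑ m, (christoffel g m j k x * christoffel g l i m x
      - christoffel g m i k x * christoffel g l j m x)

/-- The metric `g` is flat on `U`: its Riemann curvature tensor vanishes at every point of `U`. -/
def IsFlatOn {n : ℕ} (g : (Fin n → ℝ) → Matrix (Fin n) (Fin n) ℝ) (U : Set (Fin n → ℝ)) : Prop :=
  ∀ x ∈ U, ∀ l k i j : Fin n, riemannCurv g l k i j x = 0

/-- The diagonal metric `g = ∑ᵢ (1 / fᵢ²) (dxⁱ)²`. -/
def diagMetric {n : ℕ} (f : Fin n → (Fin n → ℝ) → ℝ) (x : Fin n → ℝ) :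
    Matrix (Fin n) (Fin n) ℝ :=
  Matrix.diagonal fun i => 1 / (f i x) ^ 2

/-- A nonempty open interval of `ℝ`, possibly unbounded. -/
def IsOpenInterval (I : Set ℝ) : Prop :=
  IsOpen I ∧ I.OrdConnected ∧ I.Nonempty

/-- The box `I₁ × I₂ × I₃`; the coordinates `x¹, x², x³` are `x 0, x 1, x 2`. -/
def box (I₁ I₂ I₃ : Set ℝ) : Set (Fin 3 → ℝ) :=
  {x | x 0 ∈ I₁ ∧ x 1 ∈ I₂ ∧ x 2 ∈ I₃}

/-- `f` is a nonzero constant on `I`. -/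
def IsConstForm (I : Set ℝ) (f : ℝ → ℝ) : Prop :=
  ∃ k : ℝ, k ≠ 0 ∧ ∀ t ∈ I, f t = k

/-- `f(t) = k / (t - c)` on `I`, with `k ≠ 0` and `c ∉ I`. -/
def IsHyperbolicForm (I : Set ℝ) (f : ℝ → ℝ) : Prop :=
  ∃ k c : ℝ, k ≠ 0 ∧ c ∉ I ∧ ∀ t ∈ I, f t = k / (t - c)

/-- The set of all `z ≠ 0` at which `1 / √(-2k ln|z| + r)` is defined. -/
def logDomain (k r : ℝ) : Set ℝ :=
  {z | z ≠ 0 ∧ 0 < -2 * k * Real.log |z| + r}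

/-- `D` is a maximal connected domain in `ℝ \ {0}` of `z ↦ 1 / √(-2k ln|z| + r)`. -/
def IsMaxLogDomain (k r : ℝ) (D : Set ℝ) : Prop :=
  ∃ z ∈ logDomain k r, D = connectedComponentIn (logDomain k r) z

/-- `F` is an antiderivative of `z ↦ 1 / √(-2k ln|z| + r)` on `D`. -/
def IsLogAntideriv (k r : ℝ) (D : Set ℝ) (F : ℝ → ℝ) : Prop :=
  ∀ z ∈ D, HasDerivAt F (1 / √(-2 * k * Real.log |z| + r)) z

/-- `f(t) = 1 / F⁻¹(η t + d)` on `I`, where `F⁻¹ : F(D) → D` is the inverse of `F` on `D`,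
`η = ±1`, and `η t + d ∈ F(D)` for all `t ∈ I`. -/
def IsMonotoneForm (I D : Set ℝ) (F f : ℝ → ℝ) : Prop :=
  ∃ η d : ℝ, (η = 1 ∨ η = -1) ∧
    ∀ t ∈ I, η * t + d ∈ F '' D ∧ f t = 1 / Function.invFunOn F D (η * t + d)

/-- The form with a critical point `t₀ ∈ I`: for some `z₀ ∈ ∂D \ {0}`, with `ε = sign(-k z₀)` and
`c = lim_{z → z₀} F(z) - ε t₀`,
* `f(t) = 1 / F⁻¹(-ε t + 2 ε t₀ + c)` for `t < t₀`,
* `f(t₀) = 1 / lim_{s ↘ t₀} F⁻¹(ε s + c)`,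
* `f(t) = 1 / F⁻¹(ε t + c)` for `t > t₀`,
where the arguments of `F⁻¹ : F(D) → D` lie in `F(D)` and the limits exist. -/
def IsCriticalForm (I : Set ℝ) (k : ℝ) (D : Set ℝ) (F f : ℝ → ℝ) : Prop :=
  ∃ t₀ ∈ I, ∃ z₀ ∈ frontier D \ {0}, ∃ ε c F₀ L : ℝ,
    ε = Real.sign (-k * z₀) ∧
    Filter.Tendsto F (nhdsWithin z₀ D) (nhds F₀) ∧ c = F₀ - ε * t₀ ∧
    (∀ t ∈ I, t < t₀ → -ε * t + 2 * ε * t₀ + c ∈ F '' D ∧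
      f t = 1 / Function.invFunOn F D (-ε * t + 2 * ε * t₀ + c)) ∧
    Filter.Tendsto (fun s => Function.invFunOn F D (ε * s + c))
      (nhdsWithin t₀ (Set.Ioi t₀)) (nhds L) ∧
    f t₀ = 1 / L ∧
    (∀ t ∈ I, t₀ < t → ε * t + c ∈ F '' D ∧
      f t = 1 / Function.invFunOn F D (ε * t + c))

/-- `f` has one of the two inverse-antiderivative forms on `I` with parameter `k`. -/
def IsInverseForm (I : Set ℝ) (k : ℝ) (f : ℝ → ℝ) : Prop :=
  ∃ (r : ℝ) (D : Set ℝ) (F : ℝ → ℝ), IsMaxLogDomain k r D ∧ IsLogAntideriv k r D F ∧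
    (IsMonotoneForm I D F f ∨ IsCriticalForm I k D F f)

end

/-! ### Curvature of the metric `u(x²)² (dx¹)² + v(x¹)² (dx²)² + w(x³)² (dx³)²` -/

/-! Put `u = 1/f₁`, `v = 1/f₂`, `w = 1/f₃`. The `x³` line splits off, so the only curvature is the
Gauss curvature of `u(x²)² (dx¹)² + v(x¹)² (dx²)²`, which is `-(u u'' + v v'') / (u v)²`
(`isFlatOn_crossMetric_iff`). The variables separate: flatness means `u u'' = -k` and `v v'' = k`
for one constant `k`.

If `k = 0`, both functions are affine, and their reciprocals are the constant and hyperbolic forms.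
If `k ≠ 0`, the energy identity `u'² = -2k ln|u| + r` shows that `F ∘ u` has slope `±1` wherever `u'
≠ 0`. Since `u''` has constant sign, `u'` vanishes at most once: never gives form (5a), once gives
(5b) (`isInverseForm_of_mul_deriv_deriv_eq`). Conversely, either form yields the energy identity
away from the critical point; differentiating it recovers the equation, and continuity of `u''`
covers the critical point (`mul_deriv_deriv_eq_of_isInverseForm`). -/

theorem partialD_congr {n : ℕ} {i : Fin n} {h h' : (Fin n → ℝ) → ℝ} {x : Fin n → ℝ}
    (e : h =ᶠ[nhds x] h') : partialD i h x = partialD i h' x := by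
  unfold partialD
  rw [e.fderiv_eq]

/-- Each Christoffel symbol of the metric is a product of one-variable functions, so this product
rule differentiates all of them at once. -/
theorem partialD_separated {p q s : ℝ → ℝ} {p' q' s' : ℝ} {x : Fin 3 → ℝ} (i : Fin 3)
    (hp : HasDerivAt p p' (x 0)) (hq : HasDerivAt q q' (x 1)) (hs : HasDerivAt s s' (x 2)) :
    partialD i (fun y => p (y 0) * q (y 1) * s (y 2)) x =
      ![p' * q (x 1) * s (x 2), p (x 0) * q' * s (x 2), p (x 0) * q (x 1) * s'] i := by
  have h0 := hp.comp_hasFDerivAt x (hasFDerivAt_apply (𝕜 := ℝ) (0 : Fin 3) x)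
  have h1 := hq.comp_hasFDerivAt x (hasFDerivAt_apply (𝕜 := ℝ) (1 : Fin 3) x)
  have h2 := hs.comp_hasFDerivAt x (hasFDerivAt_apply (𝕜 := ℝ) (2 : Fin 3) x)
  have h := (h0.mul h1).mul h2
  unfold partialD
  have e : (fun y : Fin 3 → ℝ => p (y 0) * q (y 1) * s (y 2)) =
    ((p ∘ fun f => f 0) * (q ∘ fun f => f 1) * (s ∘ fun f => f 2)) := rfl
  rw [e, h.fderiv]
  fin_cases i <;> simp <;> ring

/-- The metric `u(x²)² (dx¹)² + v(x¹)² (dx²)² + w(x³)² (dx³)²`. -/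
noncomputable def crossMetric (u v w : ℝ → ℝ) (x : Fin 3 → ℝ) : Matrix (Fin 3) (Fin 3) ℝ :=
  Matrix.diagonal ![u (x 1) ^ 2, v (x 0) ^ 2, w (x 2) ^ 2]

theorem diagMetric_eq_crossMetric (f₁ f₂ f₃ : ℝ → ℝ) :
    diagMetric ![fun x => f₁ (x 1), fun x => f₂ (x 0), fun x => f₃ (x 2)] =
      crossMetric (fun t => 1 / f₁ t) (fun t => 1 / f₂ t) (fun t => 1 / f₃ t) := by
  funext x
  unfold diagMetric crossMetric
  congr 1
  funext i
  fin_cases i <;> simp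

/-- First-variable factor of the Christoffel symbols of `crossMetric u v w`. -/
noncomputable def crossGammaP (v : ℝ → ℝ) : Fin 3 → Fin 3 → Fin 3 → ℝ → ℝ
  | 0, 0, 1 => fun _ => 1
  | 0, 1, 0 => fun _ => 1
  | 0, 1, 1 => fun t => -(v t * deriv v t)
  | 1, 0, 0 => fun t => (v t ^ 2)⁻¹
  | 1, 0, 1 => fun t => deriv v t / v t
  | 1, 1, 0 => fun t => deriv v t / v t
  | 2, 2, 2 => fun _ => 1
  | _, _, _ => fun _ => 0

/-- Second-variable factor of the Christoffel symbols of `crossMetric u v w`. -/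
noncomputable def crossGammaQ (u : ℝ → ℝ) : Fin 3 → Fin 3 → Fin 3 → ℝ → ℝ
  | 0, 0, 1 => fun t => deriv u t / u t
  | 0, 1, 0 => fun t => deriv u t / u t
  | 0, 1, 1 => fun t => (u t ^ 2)⁻¹
  | 1, 0, 0 => fun t => -(u t * deriv u t)
  | _, _, _ => fun _ => 1

/-- Third-variable factor of the Christoffel symbols of `crossMetric u v w`. -/
noncomputable def crossGammaS (w : ℝ → ℝ) : Fin 3 → Fin 3 → Fin 3 → ℝ → ℝ
  | 2, 2, 2 => fun t => deriv w t / w t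
  | _, _, _ => fun _ => 1

/-- Derivative of `crossGammaP`. -/
noncomputable def crossGammaP' (v : ℝ → ℝ) : Fin 3 → Fin 3 → Fin 3 → ℝ → ℝ
  | 0, 1, 1 => fun t => -(deriv v t * deriv v t + v t * deriv (deriv v) t)
  | 1, 0, 0 => fun t => -(2 * v t * deriv v t) / (v t ^ 2) ^ 2
  | 1, 0, 1 => fun t => (deriv (deriv v) t * v t - deriv v t * deriv v t) / v t ^ 2
  | 1, 1, 0 => fun t => (deriv (deriv v) t * v t - deriv v t * deriv v t) / v t ^ 2
  | _, _, _ => fun _ => 0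

/-- Derivative of `crossGammaQ`. -/
noncomputable def crossGammaQ' (u : ℝ → ℝ) : Fin 3 → Fin 3 → Fin 3 → ℝ → ℝ
  | 0, 0, 1 => fun t => (deriv (deriv u) t * u t - deriv u t * deriv u t) / u t ^ 2
  | 0, 1, 0 => fun t => (deriv (deriv u) t * u t - deriv u t * deriv u t) / u t ^ 2
  | 0, 1, 1 => fun t => -(2 * u t * deriv u t) / (u t ^ 2) ^ 2
  | 1, 0, 0 => fun t => -(deriv u t * deriv u t + u t * deriv (deriv u) t)
  | _, _, _ => fun _ => 0

/-- Derivative of `crossGammaS`. -/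
noncomputable def crossGammaS' (w : ℝ → ℝ) : Fin 3 → Fin 3 → Fin 3 → ℝ → ℝ
  | 2, 2, 2 => fun t => (deriv (deriv w) t * w t - deriv w t * deriv w t) / w t ^ 2
  | _, _, _ => fun _ => 0

section

variable {v : ℝ → ℝ} {t : ℝ}

theorem hasDerivAt_inv_sq (h0 : v t ≠ 0) (h : DifferentiableAt ℝ v t) :
    HasDerivAt (fun t => (v t ^ 2)⁻¹) (-(2 * v t * deriv v t) / (v t ^ 2) ^ 2) t := by
  have := (h.hasDerivAt.pow 2).inv (pow_ne_zero 2 h0)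
  exact this.congr_deriv (by simp)

theorem hasDerivAt_neg_mul_deriv (h : DifferentiableAt ℝ v t)
    (h' : DifferentiableAt ℝ (deriv v) t) :
    HasDerivAt (fun t => -(v t * deriv v t))
      (-(deriv v t * deriv v t + v t * deriv (deriv v) t)) t :=
  (h.hasDerivAt.mul h'.hasDerivAt).neg

theorem hasDerivAt_deriv_div (h0 : v t ≠ 0) (h : DifferentiableAt ℝ v t)
    (h' : DifferentiableAt ℝ (deriv v) t) :
    HasDerivAt (fun t => deriv v t / v t)
      ((deriv (deriv v) t * v t - deriv v t * deriv v t) / v t ^ 2) t :=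
  h'.hasDerivAt.div h.hasDerivAt h0

theorem hasDerivAt_crossGammaP (h0 : v t ≠ 0) (h : DifferentiableAt ℝ v t)
    (h' : DifferentiableAt ℝ (deriv v) t) (l i j : Fin 3) :
    HasDerivAt (crossGammaP v l i j) (crossGammaP' v l i j t) t := by
  have e1 := hasDerivAt_inv_sq h0 h
  have e2 := hasDerivAt_neg_mul_deriv h h'
  have e3 := hasDerivAt_deriv_div h0 h h'
  fin_cases l <;> fin_cases i <;> fin_cases j <;>
    first
      | exact hasDerivAt_const _ _
      | exact e1
      | exact e2
      | exact e3

theorem hasDerivAt_crossGammaQ (h0 : v t ≠ 0) (h : DifferentiableAt ℝ v t)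
    (h' : DifferentiableAt ℝ (deriv v) t) (l i j : Fin 3) :
    HasDerivAt (crossGammaQ v l i j) (crossGammaQ' v l i j t) t := by
  have e1 := hasDerivAt_inv_sq h0 h
  have e2 := hasDerivAt_neg_mul_deriv h h'
  have e3 := hasDerivAt_deriv_div h0 h h'
  fin_cases l <;> fin_cases i <;> fin_cases j <;>
    first
      | exact hasDerivAt_const _ _
      | exact e1
      | exact e2
      | exact e3

theorem hasDerivAt_crossGammaS (h0 : v t ≠ 0) (h : DifferentiableAt ℝ v t)
    (h' : DifferentiableAt ℝ (deriv v) t) (l i j : Fin 3) :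
    HasDerivAt (crossGammaS v l i j) (crossGammaS' v l i j t) t := by
  have e3 := hasDerivAt_deriv_div h0 h h'
  fin_cases l <;> fin_cases i <;> fin_cases j <;>
    first
      | exact hasDerivAt_const _ _
      | exact e3

end

theorem partialD_crossMetric {u v w : ℝ → ℝ} {x : Fin 3 → ℝ} (hu : DifferentiableAt ℝ u (x 1))
    (hv : DifferentiableAt ℝ v (x 0)) (hw : DifferentiableAt ℝ w (x 2)) (m i j : Fin 3) :
    partialD m (fun y => crossMetric u v w y i j) x =
      if i = j then ![![0, 2 * u (x 1) * deriv u (x 1), 0], ![2 * v (x 0) * deriv v (x 0), 0, 0],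
        ![0, 0, 2 * w (x 2) * deriv w (x 2)]] i m else 0 := by
  have c : ∀ (a t : ℝ), HasDerivAt (fun _ : ℝ => a) 0 t := fun a t => hasDerivAt_const t a
  have e0 := partialD_separated m (c 1 (x 0)) (hu.hasDerivAt.pow 2) (c 1 (x 2))
  have e1 := partialD_separated m (hv.hasDerivAt.pow 2) (c 1 (x 1)) (c 1 (x 2))
  have e2 := partialD_separated m (c 1 (x 0)) (c 1 (x 1)) (hw.hasDerivAt.pow 2)
  have z : partialD m (fun _ : Fin 3 → ℝ => (0 : ℝ)) x = 0 := by simp [partialD]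
  simp only [one_mul, mul_one, Pi.pow_apply] at e0 e1 e2
  unfold crossMetric
  fin_cases i <;> fin_cases j <;> simp [Matrix.diagonal, e0, e1, e2, z]

theorem christoffel_crossMetric {u v w : ℝ → ℝ} {x : Fin 3 → ℝ} (hu : DifferentiableAt ℝ u (x 1))
    (hv : DifferentiableAt ℝ v (x 0)) (hw : DifferentiableAt ℝ w (x 2))
    (hu0 : u (x 1) ≠ 0) (hv0 : v (x 0) ≠ 0) (hw0 : w (x 2) ≠ 0) (l i j : Fin 3) :
    christoffel (crossMetric u v w) l i j x =
      crossGammaP v l i j (x 0) * crossGammaQ u l i j (x 1) * crossGammaS w l i j (x 2) := by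
  have hinv : (crossMetric u v w x)⁻¹ =
      Matrix.diagonal ![(u (x 1) ^ 2)⁻¹, (v (x 0) ^ 2)⁻¹, (w (x 2) ^ 2)⁻¹] := by
    apply Matrix.inv_eq_right_inv
    rw [crossMetric, Matrix.diagonal_mul_diagonal, ← Matrix.diagonal_one]
    congr 1
    funext i
    fin_cases i <;> simp [hu0, hv0, hw0]
  unfold christoffel
  simp only [hinv, partialD_crossMetric hu hv hw, Fin.sum_univ_three]
  fin_cases l <;> fin_cases i <;> fin_cases j <;>
    simp [Matrix.diagonal, crossGammaP, crossGammaQ, crossGammaS] <;> field_simp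

set_option maxHeartbeats 4000000 in
theorem isFlatOn_crossMetric_iff {u v w : ℝ → ℝ} {U : Set (Fin 3 → ℝ)} (hU : IsOpen U)
    (hu : ∀ x ∈ U, u (x 1) ≠ 0 ∧ DifferentiableAt ℝ u (x 1) ∧ DifferentiableAt ℝ (deriv u) (x 1))
    (hv : ∀ x ∈ U, v (x 0) ≠ 0 ∧ DifferentiableAt ℝ v (x 0) ∧ DifferentiableAt ℝ (deriv v) (x 0))
    (hw : ∀ x ∈ U, w (x 2) ≠ 0 ∧ DifferentiableAt ℝ w (x 2) ∧ DifferentiableAt ℝ (deriv w) (x 2)) :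
    IsFlatOn (crossMetric u v w) U ↔
      ∀ x ∈ U, u (x 1) * deriv (deriv u) (x 1) + v (x 0) * deriv (deriv v) (x 0) = 0 := by
  have hG : ∀ x ∈ U, ∀ l i j, christoffel (crossMetric u v w) l i j x =
      crossGammaP v l i j (x 0) * crossGammaQ u l i j (x 1) * crossGammaS w l i j (x 2) :=
    fun x hx l i j => christoffel_crossMetric (hu x hx).2.1 (hv x hx).2.1 (hw x hx).2.1
      (hu x hx).1 (hv x hx).1 (hw x hx).1 l i j
  have hD : ∀ x ∈ U, ∀ m l i j, partialD m (christoffel (crossMetric u v w) l i j) x =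
      ![crossGammaP' v l i j (x 0) * crossGammaQ u l i j (x 1) * crossGammaS w l i j (x 2),
        crossGammaP v l i j (x 0) * crossGammaQ' u l i j (x 1) * crossGammaS w l i j (x 2),
        crossGammaP v l i j (x 0) * crossGammaQ u l i j (x 1) * crossGammaS' w l i j (x 2)] m := by
    intro x hx m l i j
    rw [← partialD_separated m
      (hasDerivAt_crossGammaP (hv x hx).1 (hv x hx).2.1 (hv x hx).2.2 l i j)
      (hasDerivAt_crossGammaQ (hu x hx).1 (hu x hx).2.1 (hu x hx).2.2 l i j)
      (hasDerivAt_crossGammaS (hw x hx).1 (hw x hx).2.1 (hw x hx).2.2 l i j)]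
    -- The closed formula holds on all of the open set `U`, hence near `x`, and may be
    -- differentiated.
    exact partialD_congr (Filter.eventually_of_mem (hU.mem_nhds hx) fun y hy => hG y hy l i j)
  constructor
  · intro h x hx
    have h0 := (hu x hx).1
    have h1 := (hv x hx).1
    -- This component is the Gauss curvature of the `(x¹, x²)` plane times `v²`.
    have := h x hx 0 1 0 1
    unfold riemannCurv at this
    simp only [hD x hx, hG x hx, Fin.sum_univ_three] at this
    simp [crossGammaP, crossGammaQ, crossGammaS, crossGammaP', crossGammaQ'] at this
    field_simp at this
    linarith
  · intro h x hx l k i j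
    have h0 := (hu x hx).1
    have h1 := (hv x hx).1
    have h2 := (hw x hx).1
    have hode := h x hx
    unfold riemannCurv
    simp only [hD x hx, hG x hx, Fin.sum_univ_three]
    fin_cases l <;> fin_cases k <;> fin_cases i <;> fin_cases j <;>
      simp [crossGammaP, crossGammaQ, crossGammaS, crossGammaP', crossGammaQ', crossGammaS'] <;>
      field_simp <;> grind

/-! ### The equation `u u'' = -k` -/

theorem IsOpenInterval.isPreconnected {I : Set ℝ} (h : IsOpenInterval I) : IsPreconnected I :=
  h.2.1.isPreconnected

theorem exists_sign_of_ne_zero {J : Set ℝ} {h : ℝ → ℝ} (hJ : IsPreconnected J)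
    (hc : ContinuousOn h J) (h0 : ∀ t ∈ J, h t ≠ 0) :
    ∃ η : ℝ, (η = 1 ∨ η = -1) ∧ ∀ t ∈ J, 0 < η * h t := by
  by_cases hp : ∀ t ∈ J, 0 < h t
  · exact ⟨1, Or.inl rfl, fun t ht => by simpa using hp t ht⟩
  · push Not at hp
    obtain ⟨a, ha, hle⟩ := hp
    refine ⟨-1, Or.inr rfl, fun t ht => ?_⟩
    by_contra hn
    have hpos : 0 ≤ h t := by linarith
    obtain ⟨b, hb, hb0⟩ := hJ.intermediate_value ha ht hc ⟨hle, hpos⟩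
    exact h0 b hb hb0

theorem exists_eq_linear_of_hasDerivAt_const {J : Set ℝ} {h : ℝ → ℝ} {η : ℝ} (hJo : IsOpen J)
    (hJ : IsPreconnected J) (hd : ∀ t ∈ J, HasDerivAt h η t) :
    ∃ d, ∀ t ∈ J, h t = η * t + d := by
  have hd' : ∀ t ∈ J, HasDerivAt (fun t => h t - η * t) 0 t := fun t ht =>
    ((hd t ht).sub ((hasDerivAt_id t).const_mul η)).congr_deriv (by simp)
  rcases J.eq_empty_or_nonempty with rfl | ⟨a, ha⟩
  · exact ⟨0, fun t ht => ht.elim⟩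
  · refine ⟨h a - η * a, fun t ht => ?_⟩
    have := hJo.is_const_of_deriv_eq_zero hJ
      (fun t ht => (hd' t ht).differentiableAt.differentiableWithinAt)
      (fun t ht => (hd' t ht).deriv) ht ha
    linarith

/-! ### Maximal domains and antiderivatives -/

theorem IsMaxLogDomain.subset {k r : ℝ} {D : Set ℝ} (h : IsMaxLogDomain k r D) :
    D ⊆ logDomain k r := by
  obtain ⟨z, -, rfl⟩ := h
  exact connectedComponentIn_subset _ _

theorem IsMaxLogDomain.ordConnected {k r : ℝ} {D : Set ℝ} (h : IsMaxLogDomain k r D) :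
    D.OrdConnected := by
  obtain ⟨z, -, rfl⟩ := h
  exact isPreconnected_connectedComponentIn.ordConnected

theorem isOpen_logDomain (k r : ℝ) : IsOpen (logDomain k r) := by
  have hc : ContinuousOn (fun z : ℝ => -2 * k * Real.log z + r) {0}ᶜ :=
    (continuousOn_const.mul Real.continuousOn_log).add continuousOn_const
  have := hc.isOpen_inter_preimage isOpen_compl_singleton (isOpen_Ioi (a := (0 : ℝ)))
  convert this using 1
  ext z
  simp [logDomain]

theorem IsMaxLogDomain.isOpen {k r : ℝ} {D : Set ℝ} (h : IsMaxLogDomain k r D) : IsOpen D := by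
  obtain ⟨z, -, rfl⟩ := h
  exact (isOpen_logDomain k r).connectedComponentIn

/-- On each half-line `-2k ln|z| + r` is monotone, so positivity at two points of the same sign
propagates to the segment between them, which avoids `0`. -/
theorem mem_connectedComponentIn_logDomain {k r a b : ℝ} (ha : a ∈ logDomain k r)
    (hb : b ∈ logDomain k r) (hab : 0 < a * b) : b ∈ connectedComponentIn (logDomain k r) a := by
  have hsub : Set.uIcc a b ⊆ logDomain k r := by
    have key : ∀ x y z : ℝ, 0 < x → x ≤ z → z ≤ y → 0 < -2 * k * Real.log x + r →
        0 < -2 * k * Real.log y + r → 0 < -2 * k * Real.log z + r := by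
      intro x y z hx hxz hzy h1 h2
      have l1 := Real.log_le_log hx hxz
      have l2 := Real.log_le_log (hx.trans_le hxz) hzy
      rcases le_total 0 k with hk | hk <;> nlinarith
    intro z hz
    obtain ⟨-, ha⟩ := ha
    obtain ⟨-, hb⟩ := hb
    rcases pos_and_pos_or_neg_and_neg_of_mul_pos hab with ⟨pa, pb⟩ | ⟨pa, pb⟩
    · rw [abs_of_pos pa] at ha
      rw [abs_of_pos pb] at hb
      rcases Set.mem_uIcc.1 hz with ⟨h1, h2⟩ | ⟨h1, h2⟩
      · exact ⟨by linarith, by rw [abs_of_pos (by linarith)]; exact key a b z pa h1 h2 ha hb⟩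
      · exact ⟨by linarith, by rw [abs_of_pos (by linarith)]; exact key b a z pb h1 h2 hb ha⟩
    · rw [abs_of_neg pa] at ha
      rw [abs_of_neg pb] at hb
      rcases Set.mem_uIcc.1 hz with ⟨h1, h2⟩ | ⟨h1, h2⟩
      · refine ⟨by linarith, ?_⟩
        rw [abs_of_neg (by linarith)]
        exact key (-b) (-a) (-z) (by linarith) (by linarith) (by linarith) hb ha
      · refine ⟨by linarith, ?_⟩
        rw [abs_of_neg (by linarith)]
        exact key (-a) (-b) (-z) (by linarith) (by linarith) (by linarith) ha hb
  exact isPreconnected_uIcc.subset_connectedComponentIn Set.left_mem_uIcc hsub Set.right_mem_uIcc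

theorem exists_isLogAntideriv {k r : ℝ} {D : Set ℝ} (h : IsMaxLogDomain k r D) :
    ∃ F, IsLogAntideriv k r D F := by
  have hc : ContinuousOn (fun z : ℝ => 1 / √(-2 * k * Real.log |z| + r)) D := by
    simp only [Real.log_abs]
    refine continuousOn_const.div (ContinuousOn.sqrt ?_) ?_
    · exact (continuousOn_const.mul (Real.continuousOn_log.mono fun z hz => (h.subset hz).1)).add
        continuousOn_const
    · intro z hz
      have := (h.subset hz).2
      rw [Real.log_abs] at this
      exact (Real.sqrt_pos.2 this).ne'
  have hD := h.ordConnected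
  have ho := h.isOpen
  obtain ⟨a, ha, rfl⟩ := h
  have haD := mem_connectedComponentIn ha
  refine ⟨fun z => ∫ x in a..z, 1 / √(-2 * k * Real.log |x| + r), fun z hz => ?_⟩
  exact intervalIntegral.integral_hasDerivAt_right
    (hc.mono (hD.uIcc_subset haD hz)).intervalIntegrable
    (hc.stronglyMeasurableAtFilter ho z hz) (hc.continuousAt (ho.mem_nhds hz))

theorem IsLogAntideriv.injOn {k r : ℝ} {D : Set ℝ} {F : ℝ → ℝ} (hF : IsLogAntideriv k r D F)
    (hD : IsMaxLogDomain k r D) : D.InjOn F := by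
  refine (strictMonoOn_of_deriv_pos hD.ordConnected.convex
    (fun z hz => (hF z hz).continuousAt.continuousWithinAt) fun z hz => ?_).injOn
  have hz := interior_subset hz
  rw [(hF z hz).deriv]
  exact one_div_pos.2 (Real.sqrt_pos.2 (hD.subset hz).2)

/-! ### From the inverse forms to `u u'' = -k` -/

theorem mul_deriv_deriv_eq_of_antideriv_comp {k r η d : ℝ} {J D : Set ℝ} {F u : ℝ → ℝ}
    (hJ : IsOpen J) (hD : IsMaxLogDomain k r D) (hF : IsLogAntideriv k r D F)
    (hη : η = 1 ∨ η = -1) (hu : ∀ t ∈ J, DifferentiableAt ℝ u t)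
    (hu' : ∀ t ∈ J, DifferentiableAt ℝ (deriv u) t)
    (h : ∀ t ∈ J, u t ∈ D ∧ F (u t) = η * t + d) :
    ∀ t ∈ J, u t * deriv (deriv u) t = -k := by
  have hη2 : η ^ 2 = 1 := by rcases hη with rfl | rfl <;> norm_num
  have hE : ∀ t ∈ J, deriv u t ^ 2 = -2 * k * Real.log (u t) + r := by
    intro t ht
    have h1 := (hF (u t) (h t ht).1).comp t (hu t ht).hasDerivAt
    have h2 : HasDerivAt (F ∘ u) η t := by
      have h3 : HasDerivAt (fun t => η * t + d) η t := by
        simpa using ((hasDerivAt_id t).const_mul η).add_const d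
      exact h3.congr_of_eventuallyEq
        (Filter.eventually_of_mem (hJ.mem_nhds ht) fun s hs => (h s hs).2)
    have h4 := h1.unique h2
    have h5 := (hD.subset (h t ht).1).2
    have h6 := Real.sqrt_pos.2 h5
    have h7 : deriv u t = η * √(-2 * k * Real.log |u t| + r) := by
      rw [one_div, inv_mul_eq_iff_eq_mul₀ h6.ne'] at h4
      rw [h4, mul_comm]
    rw [h7, mul_pow, hη2, Real.sq_sqrt h5.le, one_mul, Real.log_abs]
  -- Differentiating the energy identity gives `2 u' u'' = -2k u'/u`; the factor `u'` can be
  -- cancelled because `logDomain` demands strict positivity.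
  have hne : ∀ t ∈ J, deriv u t ≠ 0 := by
    intro t ht h0
    have h5 := (hD.subset (h t ht).1).2
    rw [Real.log_abs, ← hE t ht, h0] at h5
    norm_num at h5
  intro t ht
  have u0 := (hD.subset (h t ht).1).1
  have d1 := (hu' t ht).hasDerivAt.pow 2
  have d2 := (((hu t ht).hasDerivAt.log u0).const_mul (-2 * k)).add_const r
  have d3 := d1.unique (d2.congr_of_eventuallyEq
    (Filter.eventually_of_mem (hJ.mem_nhds ht) fun s hs => hE s hs))
  have n := hne t ht
  simp at d3
  field_simp at d3
  linarith

theorem mul_deriv_deriv_eq_of_isInverseForm {I : Set ℝ} (hI : IsOpenInterval I) {k : ℝ}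
    (hk : k ≠ 0) {f u : ℝ → ℝ} (hfu : ∀ t ∈ I, f t = 1 / u t)
    (hu : ∀ t ∈ I, DifferentiableAt ℝ u t) (hu' : ∀ t ∈ I, DifferentiableAt ℝ (deriv u) t)
    (hu'' : ContinuousOn (deriv (deriv u)) I) (h : IsInverseForm I k f) :
    ∀ t ∈ I, u t * deriv (deriv u) t = -k := by
  obtain ⟨r, D, F, hD, hF, h⟩ := h
  -- On `F '' D`, `invFunOn` is a right inverse with values in `D`, so the formula for `f` becomes
  -- an equation for `F (u t)`.
  have inv : ∀ t ∈ I, ∀ y ∈ F '' D, f t = 1 / Function.invFunOn F D y → u t ∈ D ∧ F (u t) = y := by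
    intro t ht y hy e
    rw [hfu t ht, one_div, one_div, inv_inj] at e
    rw [e]
    exact ⟨Function.invFunOn_mem hy, Function.invFunOn_eq hy⟩
  rcases h with ⟨η, d, hη, h⟩ | ⟨t₀, ht₀, z₀, hz₀, ε, c, F₀, L, hε, -, -, hl, -, -, hr⟩
  · exact mul_deriv_deriv_eq_of_antideriv_comp hI.1 hD hF hη hu hu'
      fun t ht => inv t ht _ (h t ht).1 (h t ht).2
  · have hε1 : ε = 1 ∨ ε = -1 := by
      rw [hε]
      exact (Real.sign_apply_eq_of_ne_zero _ (mul_ne_zero (neg_ne_zero.2 hk) hz₀.2)).symm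
    have hε2 : -ε = 1 ∨ -ε = -1 := by rcases hε1 with rfl | rfl <;> simp
    have hlt := mul_deriv_deriv_eq_of_antideriv_comp (d := 2 * ε * t₀ + c)
      (hI.1.inter (isOpen_Iio (a := t₀))) hD hF hε2
      (fun t ht => hu t ht.1) (fun t ht => hu' t ht.1) fun t ht => by
        rw [← add_assoc]; exact inv t ht.1 _ (hl t ht.1 ht.2).1 (hl t ht.1 ht.2).2
    have hgt := mul_deriv_deriv_eq_of_antideriv_comp
      (hI.1.inter (isOpen_Ioi (a := t₀))) hD hF hε1
      (fun t ht => hu t ht.1) (fun t ht => hu' t ht.1)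
      fun t ht => inv t ht.1 _ (hr t ht.1 ht.2).1 (hr t ht.1 ht.2).2
    intro t ht
    rcases lt_trichotomy t t₀ with h | rfl | h
    · exact hlt t ⟨ht, h⟩
    -- At the critical point the equation is the limit of its validity to the right.
    · have hc : ContinuousAt (fun s => u s * deriv (deriv u) s) t :=
        (hu t ht).continuousAt.mul (hu''.continuousAt (hI.1.mem_nhds ht))
      have h1 := hc.tendsto.mono_left (nhdsWithin_le_nhds (s := Set.Ioi t))
      have h2 : (fun s => u s * deriv (deriv u) s) =ᶠ[nhdsWithin t (Set.Ioi t)] fun _ => -k := by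
        filter_upwards [self_mem_nhdsWithin, nhdsWithin_le_nhds (hI.1.mem_nhds ht)] with s h1 h2
        exact hgt s ⟨h2, h1⟩
      exact tendsto_nhds_unique h1 (tendsto_const_nhds.congr' h2.symm)
    · exact hgt t ⟨ht, h⟩

/-! ### From `u u'' = -k` to the inverse forms -/

/-- Conservation of energy: `u'² + 2k ln|u|` has derivative `2u'(u'' + k/u) = 0`. -/
theorem exists_deriv_sq_eq {I : Set ℝ} (hI : IsOpenInterval I) {k : ℝ} {u : ℝ → ℝ}
    (hu0 : ∀ t ∈ I, u t ≠ 0) (hu : ∀ t ∈ I, DifferentiableAt ℝ u t)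
    (hu' : ∀ t ∈ I, DifferentiableAt ℝ (deriv u) t)
    (h : ∀ t ∈ I, u t * deriv (deriv u) t = -k) :
    ∃ r, ∀ t ∈ I, deriv u t ^ 2 = -2 * k * Real.log |u t| + r := by
  obtain ⟨r, hr⟩ := exists_eq_linear_of_hasDerivAt_const (η := 0)
    (h := fun t => deriv u t ^ 2 + 2 * k * Real.log (u t)) hI.1 hI.isPreconnected fun t ht => by
      have u0 := hu0 t ht
      refine (((hu' t ht).hasDerivAt.pow 2).add
        (((hu t ht).hasDerivAt.log u0).const_mul (2 * k))).congr_deriv ?_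
      have := h t ht
      simp
      field_simp
      linear_combination 2 * deriv u t * this
  refine ⟨r, fun t ht => ?_⟩
  have := hr t ht
  rw [Real.log_abs]
  linarith

/-- By the energy identity, `(F ∘ u)' = u' / |u'| = η`. -/
theorem exists_antideriv_comp_eq {k r η : ℝ} {J D : Set ℝ} {F u : ℝ → ℝ}
    (hJ : IsOpen J) (hJ' : IsPreconnected J) (hF : IsLogAntideriv k r D F)
    (hη : η = 1 ∨ η = -1) (hu : ∀ t ∈ J, DifferentiableAt ℝ u t)
    (hE : ∀ t ∈ J, deriv u t ^ 2 = -2 * k * Real.log |u t| + r)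
    (hpos : ∀ t ∈ J, 0 < η * deriv u t) (huD : ∀ t ∈ J, u t ∈ D) :
    ∃ d, ∀ t ∈ J, F (u t) = η * t + d := by
  refine exists_eq_linear_of_hasDerivAt_const hJ hJ' fun t ht => ?_
  refine ((hF (u t) (huD t ht)).comp t (hu t ht).hasDerivAt).congr_deriv ?_
  have hp := hpos t ht
  have e : √(-2 * k * Real.log |u t| + r) = η * deriv u t := by
    rw [← hE t ht, Real.sqrt_eq_iff_mul_self_eq (sq_nonneg _) hp.le]
    rcases hη with rfl | rfl <;> ring
  rw [e]
  have : deriv u t ≠ 0 := right_ne_zero_of_mul hp.ne'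
  rcases hη with rfl | rfl <;> field_simp

/-- The interval `D` omits `u t₀`, so it lies on one side of it, the side of `u s` for `s > t₀`. By
the intermediate value theorem every `z ∈ D` near `u t₀` is `u a` with `a` slightly above `t₀`,
where `F z = ε a + c`. -/
theorem tendsto_nhdsWithin_of_antideriv_comp {I D : Set ℝ} {F u : ℝ → ℝ} {t₀ ε c : ℝ}
    (hI : IsOpenInterval I) (ht₀ : t₀ ∈ I) (hD : D.OrdConnected) (hε : ε = 1 ∨ ε = -1)
    (hu : ContinuousOn u I) (hz : u t₀ ∉ D)
    (h : ∀ t ∈ I, t₀ < t → u t ∈ D ∧ F (u t) = ε * t + c) :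
    Filter.Tendsto F (nhdsWithin (u t₀) D) (nhds (ε * t₀ + c)) := by
  rw [Metric.tendsto_nhdsWithin_nhds]
  intro δ hδ
  obtain ⟨ρ, hρ, hball⟩ := Metric.isOpen_iff.1 hI.1 t₀ ht₀
  set s := t₀ + min (δ / 2) (ρ / 2) with hs
  have hm : 0 < min (δ / 2) (ρ / 2) := lt_min (by linarith) (by linarith)
  have hsI : s ∈ I := by
    apply hball
    rw [Metric.mem_ball, Real.dist_eq, hs, add_sub_cancel_left, abs_of_pos hm]
    linarith [min_le_right (δ / 2) (ρ / 2)]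
  have hsδ : s - t₀ < δ := by
    rw [hs, add_sub_cancel_left]
    linarith [min_le_left (δ / 2) (ρ / 2)]
  have hts : t₀ < s := by linarith
  have hsub : Set.uIcc t₀ s ⊆ I := hI.2.1.uIcc_subset ht₀ hsI
  have husD := (h s hsI hts).1
  have hne : u s ≠ u t₀ := fun e => hz (e ▸ husD)
  refine ⟨|u s - u t₀|, abs_pos.2 (sub_ne_zero.2 hne), fun z hzD hdist => ?_⟩
  have hz0 : z ≠ u t₀ := fun e => hz (e ▸ hzD)
  rw [Real.dist_eq] at hdist
  have hmem : z ∈ Set.uIcc (u t₀) (u s) := by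
    rw [Set.mem_uIcc]
    rcases lt_or_gt_of_ne hne with hlt | hlt
    · right
      rw [abs_of_neg (by linarith : u s - u t₀ < 0)] at hdist
      have := abs_lt.1 hdist
      refine ⟨by linarith, ?_⟩
      -- Otherwise `u t₀` would lie between two points of `D`.
      by_contra hcon
      exact hz (hD.out husD hzD ⟨hlt.le, (not_le.1 hcon).le⟩)
    · left
      rw [abs_of_pos (by linarith : 0 < u s - u t₀)] at hdist
      have := abs_lt.1 hdist
      refine ⟨?_, by linarith⟩
      by_contra hcon
      exact hz (hD.out hzD husD ⟨(not_le.1 hcon).le, hlt.le⟩)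
  obtain ⟨a, ha, rfl⟩ := intermediate_value_uIcc (hu.mono hsub) hmem
  have haI := hsub ha
  rw [Set.uIcc_of_le hts.le] at ha
  have hta : t₀ < a := lt_of_le_of_ne ha.1 fun e => hz0 (by rw [e])
  rw [(h a haI hta).2, Real.dist_eq, show ε * a + c - (ε * t₀ + c) = ε * (a - t₀) by ring, abs_mul,
    abs_of_pos (by linarith : 0 < a - t₀)]
  have : |ε| = 1 := by rcases hε with rfl | rfl <;> simp
  rw [this]
  linarith [ha.2]

theorem isInverseForm_of_mul_deriv_deriv_eq {I : Set ℝ} (hI : IsOpenInterval I) {k : ℝ}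
    (hk : k ≠ 0) {f u : ℝ → ℝ} (hfu : ∀ t ∈ I, f t = 1 / u t) (hu0 : ∀ t ∈ I, u t ≠ 0)
    (hu : ∀ t ∈ I, DifferentiableAt ℝ u t) (hu' : ∀ t ∈ I, DifferentiableAt ℝ (deriv u) t)
    (h : ∀ t ∈ I, u t * deriv (deriv u) t = -k) : IsInverseForm I k f := by
  have huc : ContinuousOn u I := fun t ht => (hu t ht).continuousAt.continuousWithinAt
  have huc' : ContinuousOn (deriv u) I := fun t ht => (hu' t ht).continuousAt.continuousWithinAt
  obtain ⟨r, hE⟩ := exists_deriv_sq_eq hI hu0 hu hu' h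
  obtain ⟨σ, hσ, hσu⟩ := exists_sign_of_ne_zero hI.isPreconnected huc hu0
  have hσ2 : σ ^ 2 = 1 := by rcases hσ with rfl | rfl <;> norm_num
  have hsame : ∀ s ∈ I, ∀ t ∈ I, 0 < u s * u t := fun s hs t ht => by
    have := mul_pos (hσu s hs) (hσu t ht)
    rwa [show σ * u s * (σ * u t) = σ ^ 2 * (u s * u t) by ring, hσ2, one_mul] at this
  -- If `u'` vanished on `I`, so would `u''`, against `k ≠ 0`. The value `u a` selects the component
  -- `D`; as `u` keeps its sign, all noncritical values lie in it.
  obtain ⟨a, ha, ha0⟩ : ∃ a ∈ I, deriv u a ≠ 0 := by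
    by_contra! hcon
    obtain ⟨a, ha⟩ := hI.2.2
    have e : deriv u =ᶠ[nhds a] fun _ => 0 :=
      Filter.eventually_of_mem (hI.1.mem_nhds ha) hcon
    have := h a ha
    rw [e.deriv_eq] at this
    simp at this
    exact hk this
  have hlog : ∀ t ∈ I, deriv u t ≠ 0 → u t ∈ logDomain k r := fun t ht h0 =>
    ⟨hu0 t ht, by rw [← hE t ht]; positivity⟩
  set D := connectedComponentIn (logDomain k r) (u a) with hDdef
  have hD : IsMaxLogDomain k r D := ⟨u a, hlog a ha ha0, rfl⟩
  have huD : ∀ t ∈ I, deriv u t ≠ 0 → u t ∈ D := fun t ht h0 =>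
    mem_connectedComponentIn_logDomain (hlog a ha ha0) (hlog t ht h0) (hsame a ha t ht)
  obtain ⟨F, hF⟩ := exists_isLogAntideriv hD
  have hinv : ∀ t ∈ I, deriv u t ≠ 0 → Function.invFunOn F D (F (u t)) = u t :=
    fun t ht h0 => (hF.injOn hD).leftInvOn_invFunOn (huD t ht h0)
  refine ⟨r, D, F, hD, hF, ?_⟩
  by_cases hcrit : ∀ t ∈ I, deriv u t ≠ 0
  · left
    obtain ⟨η, hη, hpos⟩ := exists_sign_of_ne_zero hI.isPreconnected huc' hcrit
    obtain ⟨d, hd⟩ := exists_antideriv_comp_eq hI.1 hI.isPreconnected hF hη hu hE hpos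
      fun t ht => huD t ht (hcrit t ht)
    refine ⟨η, d, hη, fun t ht => ?_⟩
    rw [← hd t ht, hinv t ht (hcrit t ht)]
    exact ⟨Set.mem_image_of_mem F (huD t ht (hcrit t ht)), hfu t ht⟩
  · right
    push Not at hcrit
    obtain ⟨t₀, ht₀, hd0⟩ := hcrit
    have hkz : -k * u t₀ ≠ 0 := mul_ne_zero (neg_ne_zero.2 hk) (hu0 t₀ ht₀)
    obtain ⟨ε, hε⟩ : ∃ ε, ε = Real.sign (-k * u t₀) := ⟨_, rfl⟩
    have hε1 : ε = 1 ∨ ε = -1 := by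
      rw [hε]
      exact (Real.sign_apply_eq_of_ne_zero _ hkz).symm
    have hε2 : -ε = 1 ∨ -ε = -1 := by rcases hε1 with e | e <;> simp [e]
    have hεpos : 0 < ε * (-k * u t₀) := by
      rw [hε]
      exact Real.sign_mul_pos_of_ne_zero _ hkz
    -- Since `u u'' = -k` and `u` keeps its sign, `u''` has the sign `ε` of `-k u t₀`. Hence `t₀` is
    -- the only zero of `u'`, and `u'` changes sign there.
    have hmono : StrictMonoOn (fun t => ε * deriv u t) I := by
      refine strictMonoOn_of_deriv_pos hI.2.1.convex (continuousOn_const.mul huc') fun t ht => ?_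
      have ht := interior_subset ht
      rw [((hu' t ht).hasDerivAt.const_mul ε).deriv]
      have h1 := hsame t ht t₀ ht₀
      have h2 : 0 < u t ^ 2 := by have := hu0 t ht; positivity
      have h3 : ε * (-k * u t₀) * (u t * u t₀) = (u t ^ 2 * u t₀ ^ 2) * (ε * deriv (deriv u) t) := by
        rw [← h t ht]; ring
      have h4 := mul_pos hεpos h1
      rw [h3] at h4
      exact pos_of_mul_pos_right h4 (by positivity)
    have hgt : ∀ t ∈ I, t₀ < t → 0 < ε * deriv u t := fun t ht hlt => by
      simpa [hd0] using hmono ht₀ ht hlt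
    have hlt : ∀ t ∈ I, t < t₀ → 0 < -ε * deriv u t := fun t ht hlt => by
      simpa [hd0] using hmono ht ht₀ hlt
    have hgt0 : ∀ t ∈ I, t₀ < t → deriv u t ≠ 0 := fun t ht hl =>
      right_ne_zero_of_mul (hgt t ht hl).ne'
    have hlt0 : ∀ t ∈ I, t < t₀ → deriv u t ≠ 0 := fun t ht hl =>
      right_ne_zero_of_mul (hlt t ht hl).ne'
    obtain ⟨c, hc⟩ := exists_antideriv_comp_eq (hI.1.inter (isOpen_Ioi (a := t₀)))
      (hI.2.1.inter Set.ordConnected_Ioi).isPreconnected hF hε1 (fun t ht => hu t ht.1)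
      (fun t ht => hE t ht.1) (fun t ht => hgt t ht.1 ht.2)
      (fun t ht => huD t ht.1 (hgt0 t ht.1 ht.2))
    obtain ⟨c', hc'⟩ := exists_antideriv_comp_eq (hI.1.inter (isOpen_Iio (a := t₀)))
      (hI.2.1.inter Set.ordConnected_Iio).isPreconnected hF hε2 (fun t ht => hu t ht.1)
      (fun t ht => hE t ht.1) (fun t ht => hlt t ht.1 ht.2)
      (fun t ht => huD t ht.1 (hlt0 t ht.1 ht.2))
    -- At `u' = 0` the energy identity makes the expression under the root vanish.
    have hz : u t₀ ∉ D := fun hmem => by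
      have := (hD.subset hmem).2
      rw [← hE t₀ ht₀, hd0] at this
      norm_num at this
    have hlim := tendsto_nhdsWithin_of_antideriv_comp hI ht₀ hD.ordConnected hε1 huc hz
      fun t ht hl => ⟨huD t ht (hgt0 t ht hl), hc t ⟨ht, hl⟩⟩
    have hIev : ∀ s : Set ℝ, ∀ᶠ t in nhdsWithin t₀ s, t ∈ I := fun s =>
      nhdsWithin_le_nhds (hI.1.mem_nhds ht₀)
    have hut : ∀ s : Set ℝ, Filter.Tendsto u (nhdsWithin t₀ s) (nhds (u t₀)) := fun s =>
      (hu t₀ ht₀).continuousAt.tendsto.mono_left nhdsWithin_le_nhds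
    have hleft : Filter.Tendsto u (nhdsWithin t₀ (Set.Iio t₀)) (nhdsWithin (u t₀) D) := by
      refine tendsto_nhdsWithin_iff.2 ⟨hut _, ?_⟩
      filter_upwards [hIev _, self_mem_nhdsWithin] with t ht hl
      exact huD t ht (hlt0 t ht hl)
    -- `F ∘ u` has the same limit from both sides of `t₀`, so `-ε t₀ + c' = ε t₀ + c`. This is the
    -- source of the term `2 ε t₀` in the form for `t < t₀`.
    have hcc : c' = 2 * ε * t₀ + c := by
      have h1 := hlim.comp hleft
      have h2 : Filter.Tendsto (F ∘ u) (nhdsWithin t₀ (Set.Iio t₀)) (nhds (-ε * t₀ + c')) := by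
        have h3 : Continuous fun t : ℝ => -ε * t + c' := by fun_prop
        refine (h3.tendsto t₀ |>.mono_left nhdsWithin_le_nhds).congr' ?_
        filter_upwards [hIev _, self_mem_nhdsWithin] with t ht hl
        exact (hc' t ⟨ht, hl⟩).symm
      have := tendsto_nhds_unique h1 h2
      linarith
    refine ⟨t₀, ht₀, u t₀, ⟨⟨?_, fun hi => hz (interior_subset hi)⟩, hu0 t₀ ht₀⟩, ε, c, ε * t₀ + c,
      u t₀, hε, hlim, by ring, fun t ht hl => ?_, ?_, hfu t₀ ht₀, fun t ht hl => ?_⟩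
    · refine mem_closure_of_tendsto (hut (Set.Iio t₀)) ?_
      filter_upwards [hIev _, self_mem_nhdsWithin] with t ht hl
      exact huD t ht (hlt0 t ht hl)
    · rw [add_assoc, ← hcc, ← hc' t ⟨ht, hl⟩, hinv t ht (hlt0 t ht hl)]
      exact ⟨Set.mem_image_of_mem F (huD t ht (hlt0 t ht hl)), hfu t ht⟩
    · refine (hut (Set.Ioi t₀)).congr' ?_
      filter_upwards [hIev _, self_mem_nhdsWithin] with t ht hl
      rw [← hc t ⟨ht, hl⟩, hinv t ht (hgt0 t ht hl)]
    · rw [← hc t ⟨ht, hl⟩, hinv t ht (hgt0 t ht hl)]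
      exact ⟨Set.mem_image_of_mem F (huD t ht (hgt0 t ht hl)), hfu t ht⟩

/-! ### The equation `u'' = 0` and the classification -/

/-- Both forms say that `u` is affine: slope zero is the constant form, nonzero slope the hyperbolic
one. -/
theorem isConstForm_or_isHyperbolicForm_iff {I : Set ℝ} (hI : IsOpenInterval I) {f u : ℝ → ℝ}
    (hfu : ∀ t ∈ I, f t = 1 / u t) (hu0 : ∀ t ∈ I, u t ≠ 0)
    (hu : ∀ t ∈ I, DifferentiableAt ℝ u t) (hu' : ∀ t ∈ I, DifferentiableAt ℝ (deriv u) t) :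
    (IsConstForm I f ∨ IsHyperbolicForm I f) ↔ ∀ t ∈ I, deriv (deriv u) t = 0 := by
  constructor
  · intro h
    obtain ⟨m, b, hmb⟩ : ∃ m b : ℝ, ∀ t ∈ I, u t = m * t + b := by
      have huf : ∀ t ∈ I, u t = (f t)⁻¹ := fun t ht => by rw [hfu t ht]; simp
      rcases h with ⟨k, -, h⟩ | ⟨k, c, -, -, h⟩
      · exact ⟨0, k⁻¹, fun t ht => by rw [huf t ht, h t ht]; ring⟩
      · exact ⟨k⁻¹, -(c * k⁻¹), fun t ht => by rw [huf t ht, h t ht, inv_div]; ring⟩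
    have hd : ∀ t ∈ I, deriv u t = m := fun t ht => by
      have h3 : HasDerivAt (fun t => m * t + b) m t := by
        simpa using ((hasDerivAt_id t).const_mul m).add_const b
      exact (h3.congr_of_eventuallyEq
        (Filter.eventually_of_mem (hI.1.mem_nhds ht) hmb)).deriv
    intro t ht
    have e : deriv u =ᶠ[nhds t] fun _ => m := Filter.eventually_of_mem (hI.1.mem_nhds ht) hd
    rw [e.deriv_eq, deriv_const]
  · intro h
    obtain ⟨m, hm⟩ := exists_eq_linear_of_hasDerivAt_const (η := 0) hI.1 hI.isPreconnected
      fun t ht => h t ht ▸ (hu' t ht).hasDerivAt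
    obtain ⟨b, hb⟩ := exists_eq_linear_of_hasDerivAt_const (η := m) hI.1 hI.isPreconnected
      fun t ht => by simpa [hm t ht] using (hu t ht).hasDerivAt
    by_cases hm0 : m = 0
    · left
      obtain ⟨a, ha⟩ := hI.2.2
      have hb0 : b ≠ 0 := by simpa [hb a ha, hm0] using hu0 a ha
      exact ⟨1 / b, one_div_ne_zero hb0, fun t ht => by rw [hfu t ht, hb t ht, hm0]; simp⟩
    · right
      -- The pole `c = -b/m` is the root of `u = m t + b`; it lies outside `I` because `u` has no
      -- zero there.
      refine ⟨1 / m, -(b / m), one_div_ne_zero hm0, fun hc => hu0 _ hc ?_, fun t ht => ?_⟩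
      · rw [hb _ hc]; field_simp; ring
      · rw [hfu t ht, hb t ht, div_div, mul_sub]
        congr 1
        field_simp
        ring

theorem forall_mul_deriv_deriv_add_eq_zero_iff {I J : Set ℝ} (hI : IsOpenInterval I)
    (hJ : IsOpenInterval J) {f h u v : ℝ → ℝ}
    (hfu : ∀ t ∈ I, f t = 1 / u t) (hhv : ∀ t ∈ J, h t = 1 / v t)
    (u0 : ∀ t ∈ I, u t ≠ 0) (v0 : ∀ t ∈ J, v t ≠ 0)
    (u1 : ∀ t ∈ I, DifferentiableAt ℝ u t) (v1 : ∀ t ∈ J, DifferentiableAt ℝ v t)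
    (u2 : ∀ t ∈ I, DifferentiableAt ℝ (deriv u) t) (v2 : ∀ t ∈ J, DifferentiableAt ℝ (deriv v) t)
    (uc : ContinuousOn (deriv (deriv u)) I) (vc : ContinuousOn (deriv (deriv v)) J) :
    (∀ t ∈ I, ∀ s ∈ J, u t * deriv (deriv u) t + v s * deriv (deriv v) s = 0) ↔
      (IsConstForm I f ∧ IsConstForm J h) ∨
      (IsHyperbolicForm I f ∧ IsConstForm J h) ∨
      (IsConstForm I f ∧ IsHyperbolicForm J h) ∨
      (IsHyperbolicForm I f ∧ IsHyperbolicForm J h) ∨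
      (∃ k₁ k₂ : ℝ, k₁ ≠ 0 ∧ k₂ = -k₁ ∧ IsInverseForm I k₁ f ∧ IsInverseForm J k₂ h) := by
  have hu := isConstForm_or_isHyperbolicForm_iff hI hfu u0 u1 u2
  have hv := isConstForm_or_isHyperbolicForm_iff hJ hhv v0 v1 v2
  constructor
  · intro H
    obtain ⟨a, ha⟩ := hI.2.2
    obtain ⟨b, hb⟩ := hJ.2.2
    -- Separation of variables: a function of `t` equal to minus a function of `s` is constant, here
    -- read off at `s = b`.
    obtain ⟨k, hk⟩ : ∃ k, k = v b * deriv (deriv v) b := ⟨_, rfl⟩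
    have eu : ∀ t ∈ I, u t * deriv (deriv u) t = -k := fun t ht => by
      linarith [H t ht b hb]
    have ev : ∀ s ∈ J, v s * deriv (deriv v) s = -(-k) := fun s hs => by
      linarith [H a ha s hs, eu a ha]
    by_cases hk0 : k = 0
    · have hu' := hu.2 fun t ht => by simpa [hk0, u0 t ht] using eu t ht
      have hv' := hv.2 fun t ht => by simpa [hk0, v0 t ht] using ev t ht
      tauto
    · exact Or.inr <| Or.inr <| Or.inr <| Or.inr ⟨k, -k, hk0, rfl,
        isInverseForm_of_mul_deriv_deriv_eq hI hk0 hfu u0 u1 u2 eu,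
        isInverseForm_of_mul_deriv_deriv_eq hJ (neg_ne_zero.2 hk0) hhv v0 v1 v2 ev⟩
  · intro H t ht s hs
    have affine : (IsConstForm I f ∨ IsHyperbolicForm I f) →
        (IsConstForm J h ∨ IsHyperbolicForm J h) →
        u t * deriv (deriv u) t + v s * deriv (deriv v) s = 0 := fun h1 h2 => by
      rw [hu.1 h1 t ht, hv.1 h2 s hs]; simp
    rcases H with ⟨h1, h2⟩ | ⟨h1, h2⟩ | ⟨h1, h2⟩ | ⟨h1, h2⟩ | ⟨k₁, k₂, hk, rfl, h1, h2⟩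
    · exact affine (Or.inl h1) (Or.inl h2)
    · exact affine (Or.inr h1) (Or.inl h2)
    · exact affine (Or.inl h1) (Or.inr h2)
    · exact affine (Or.inr h1) (Or.inr h2)
    · rw [mul_deriv_deriv_eq_of_isInverseForm hI hk hfu u1 u2 uc h1 t ht,
        mul_deriv_deriv_eq_of_isInverseForm hJ (neg_ne_zero.2 hk) hhv v1 v2 vc h2 s hs]
      ring

theorem ContDiffOn.one_div_regularity {I : Set ℝ} {f : ℝ → ℝ} (hI : IsOpen I)
    (hf : ContDiffOn ℝ ∞ f I) (hf0 : ∀ t ∈ I, f t ≠ 0) :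
    (∀ t ∈ I, 1 / f t ≠ 0) ∧ (∀ t ∈ I, DifferentiableAt ℝ (fun t => 1 / f t) t) ∧
      (∀ t ∈ I, DifferentiableAt ℝ (deriv fun t => 1 / f t) t) ∧
      ContinuousOn (deriv (deriv fun t => 1 / f t)) I := by
  have h : ContDiffOn ℝ ∞ (fun t => 1 / f t) I := contDiffOn_const.div hf hf0
  have h1 : ContDiffOn ℝ ∞ (deriv fun t => 1 / f t) I := h.deriv_of_isOpen hI le_rfl
  have h2 : ContDiffOn ℝ ∞ (deriv (deriv fun t => 1 / f t)) I := h1.deriv_of_isOpen hI le_rfl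
  exact ⟨fun t ht => one_div_ne_zero (hf0 t ht),
    fun t ht => (h.differentiableOn (by simp)).differentiableAt (hI.mem_nhds ht),
    fun t ht => (h1.differentiableOn (by simp)).differentiableAt (hI.mem_nhds ht), h2.continuousOn⟩

theorem isOpen_box {I₁ I₂ I₃ : Set ℝ} (h₁ : IsOpen I₁) (h₂ : IsOpen I₂) (h₃ : IsOpen I₃) :
    IsOpen (box I₁ I₂ I₃) :=
  (h₁.preimage (continuous_apply 0)).inter
    ((h₂.preimage (continuous_apply 1)).inter (h₃.preimage (continuous_apply 2)))

theorem theorem2p9 (I₁ I₂ I₃ : Set ℝ) (hI₁ : IsOpenInterval I₁) (hI₂ : IsOpenInterval I₂)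
    (hI₃ : IsOpenInterval I₃) (f₁ f₂ f₃ : ℝ → ℝ)
    (hf₁ : ContDiffOn ℝ ∞ f₁ I₂) (hf₂ : ContDiffOn ℝ ∞ f₂ I₁) (hf₃ : ContDiffOn ℝ ∞ f₃ I₃)
    (hf₁0 : ∀ t ∈ I₂, f₁ t ≠ 0) (hf₂0 : ∀ t ∈ I₁, f₂ t ≠ 0) (hf₃0 : ∀ t ∈ I₃, f₃ t ≠ 0) :
    IsFlatOn (diagMetric ![fun x => f₁ (x 1), fun x => f₂ (x 0), fun x => f₃ (x 2)])
        (box I₁ I₂ I₃) ↔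
      (IsConstForm I₂ f₁ ∧ IsConstForm I₁ f₂) ∨
      (IsHyperbolicForm I₂ f₁ ∧ IsConstForm I₁ f₂) ∨
      (IsConstForm I₂ f₁ ∧ IsHyperbolicForm I₁ f₂) ∨
      (IsHyperbolicForm I₂ f₁ ∧ IsHyperbolicForm I₁ f₂) ∨
      (∃ k₁ k₂ : ℝ, k₁ ≠ 0 ∧ k₂ = -k₁ ∧ IsInverseForm I₂ k₁ f₁ ∧ IsInverseForm I₁ k₂ f₂) := by
  obtain ⟨u0, u1, u2, uc⟩ := hf₁.one_div_regularity hI₂.1 hf₁0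
  obtain ⟨v0, v1, v2, vc⟩ := hf₂.one_div_regularity hI₁.1 hf₂0
  obtain ⟨w0, w1, w2, -⟩ := hf₃.one_div_regularity hI₃.1 hf₃0
  have hfu : ∀ t ∈ I₂, f₁ t = 1 / (fun t => 1 / f₁ t) t := fun t _ => (one_div_one_div _).symm
  have hfv : ∀ t ∈ I₁, f₂ t = 1 / (fun t => 1 / f₂ t) t := fun t _ => (one_div_one_div _).symm
  rw [diagMetric_eq_crossMetric, isFlatOn_crossMetric_iff (isOpen_box hI₁.1 hI₂.1 hI₃.1)
    (fun x hx => ⟨u0 _ hx.2.1, u1 _ hx.2.1, u2 _ hx.2.1⟩)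
    (fun x hx => ⟨v0 _ hx.1, v1 _ hx.1, v2 _ hx.1⟩)
    (fun x hx => ⟨w0 _ hx.2.2, w1 _ hx.2.2, w2 _ hx.2.2⟩)]
  rw [← forall_mul_deriv_deriv_add_eq_zero_iff hI₂ hI₁ hfu hfv u0 v0 u1 v1 u2 v2 uc vc]
  constructor
  · intro h t ht s hs
    -- The equation does not involve `x³`, so any point of `I₃` completes `(s, t)` to a point of the
    -- box.
    obtain ⟨z, hz⟩ := hI₃.2.2
    exact h ![s, t, z] ⟨hs, ht, hz⟩
  · exact fun h x hx => h _ hx.2.1 _ hx.1
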